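/- Let $b$ be a prime, let $m,d\in\mathbb N$ with $m\ge 4$, $d\ge 1$, and let $(\eta_j)_{j\ge1}$ be positive reals. Notation: $\mathbb F_b$ is identified with $\{0,\dots,b-1\}$. An integer $n=n_0+n_1b+n_2b^2+\cdots\ge 0$ (base-$b$ expansion) is identified with $n(x)=n_0+n_1x+n_2x^2+\cdots\in\mathbb F_b[x]$, and $\mathrm{tr}_m(n)=n_0+n_1x+\dots+n_{m-1}x^{m-1}$. For $t\in\mathbb N$ let $v_t:\mathbb F_b((x^{-1}))\to[0,1)$, $v_t\big(\sum_{\ell\ge w}t_\ell x^{-\ell}\big)=\sum_{\ell=\max(1,w)}^{t}t_\ell b^{-\ell}$. *Quality measure.* Put $r_1(0)=1$ and $r_1(k)=b^{\lfloor\log_b k\rfloor}$ for $k\ge1$. For $\boldsymbol g\in(\mathbb F_b[x])^d$ let $$T_{\boldsymbol\eta}(\boldsymbol g,x^m)=\sum_{\boldsymbol k}\ \prod_{j:\,k_j\ne0}\eta_j\ \prod_{j=1}^d\frac1{r_1(k_j)},$$ the sum being over all $\boldsymbol 0\neq\boldsymbol k\in\{0,1,\dots,b^m-1\}^d$ with $\sum_{j=1}^d\mathrm{tr}_m(k_j)\,g_j\equiv0\pmod{x^m}$.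 *Algorithm (component-by-component digit-by-digit).* Set $g_1=1$. For $r=2,\dots,d$, with $g_1,\dots,g_{r-1}$ already constructed, put $g_{r,1}=1$; for $w=2,\dots,m$ choose a $g^\ast\in\mathbb F_b$ that minimises $g\mapsto h_{r,w}(g_{r,w-1}+g\,x^{w-1})$ over $\mathbb F_b$ and put $g_{r,w}=g_{r,w-1}+g^\ast x^{w-1}$; finally set $g_r=g_{r,m}$. Here, for $q\in\mathbb F_b[x]$, $$h_{r,w}(q)=\sum_{t=w}^m\frac1{b^{t-w}}\sum_{\substack{\ell=1\\ b\nmid\ell}}^{b^t-1}\Big(1+\eta_r(1-b)\Big(\Big\lfloor\log_b v_w\Big(\tfrac{\ell(x)q(x)}{x^w}\Big)\Big\rfloor+1\Big)\Big)\prod_{j=1}^{r-1}\Big(1+\eta_j(1-b)\Big(\Big\lfloor\log_b v_t\Big(\tfrac{\ell(x)g_j(x)}{x^t}\Big)\Big\rfloor+1\Big)\Big).$$ **Theorem.** The algorithm returns a generating vector, and every vector $\boldsymbol g=(g_1,\dots,g_d)$ that it can return (whichever minimisers are chosen in case of ties) satisfies $$T_{\boldsymbol\eta}(\boldsymbol g,x^m)\le\frac1{b^m}\left[\prod_{j=1}^d\big(1+\eta_j((b-1)m+1)\big)+b\,m\prod_{j=1}^d\left(1+\eta_j\left(2(b-1)m+\frac{2b}{b-1}\right)\right)\right].$$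 -/

import Mathlib

open Polynomial Finset

noncomputable section

namespace PolyLattice

/-- The polynomial `n(x) = n₀ + n₁ x + ⋯ + n_a x^a ∈ 𝔽_b[x]` attached to the integer `n` with
base-`b` expansion `n = n₀ + n₁ b + ⋯ + n_a b^a`. -/
def natPoly (b n : ℕ) : (ZMod b)[X] :=
  ∑ i ∈ range (Nat.log b n + 1), C ((n / b ^ i % b : ℕ) : ZMod b) * X ^ i

/-- The truncation `tr_m(k) = κ₀ + κ₁ x + ⋯ + κ_{m-1} x^{m-1}` of an integer `k` with base-`b`
digits `κ₀, κ₁, …` (zero beyond the leading digit). -/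
def trunc (b m k : ℕ) : (ZMod b)[X] :=
  ∑ i ∈ range m, C ((k / b ^ i % b : ℕ) : ZMod b) * X ^ i

/-- The field `𝔽_b((x⁻¹))` is modelled as the field of Laurent series in the variable `u = x⁻¹`,
so that the coefficient of `x^{-ℓ}` is the coefficient of `u^ℓ`. This is the embedding of `𝔽_b[x]`
into `𝔽_b((x⁻¹))`, sending `x` to `u⁻¹`. -/
def toLaurentInv (b : ℕ) (q : (ZMod b)[X]) : LaurentSeries (ZMod b) :=
  q.eval₂ (HahnSeries.C : ZMod b →+* LaurentSeries (ZMod b)) (HahnSeries.single (-1 : ℤ) 1)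

/-- The map `v_m : 𝔽_b((x⁻¹)) → [0,1)`, `∑_{ℓ ≥ w} t_ℓ x^{-ℓ} ↦ ∑_{ℓ = max(1,w)}^m t_ℓ b^{-ℓ}`.
(The coefficients with `ℓ < w` vanish.) -/
def vMap (b m : ℕ) (L : LaurentSeries (ZMod b)) : ℝ :=
  ∑ l ∈ Icc 1 m, ((L.coeff (l : ℤ)).val : ℝ) * ((b : ℝ) ^ l)⁻¹

/-- `v_m (q(x) / p(x))`, the quotient being taken in `𝔽_b((x⁻¹))`. -/
def vFrac (b : ℕ) [Fact b.Prime] (m : ℕ) (q p : (ZMod b)[X]) : ℝ :=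
  vMap b m (toLaurentInv b q / toLaurentInv b p)

/-- The decay function: `r_α(0) = 1` and `r_α(k) = b^{α ⌊log_b k⌋}` for `k ≠ 0`. -/
def decay (b : ℕ) (α : ℝ) (k : ℕ) : ℝ :=
  if k = 0 then 1 else (b : ℝ) ^ (α * (Nat.log b k : ℝ))

/-- The weighted decay function for product weights,
`r_{α,η}(k) = (∏_{j ∈ supp k} η_j)⁻¹ ∏_j r_α(k_j)`. Coordinates are numbered from `0`. -/
def weightedDecay (b : ℕ) (α : ℝ) (η : ℕ → ℝ) {d : ℕ} (k : Fin d → ℕ) : ℝ :=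
  (∏ j with k j ≠ 0, η j)⁻¹ * ∏ j, decay b α (k j)

/-- The dual net `𝒟(g, p) = {k ∈ ℕ₀^d : tr_m(k) · g ≡ 0 (mod p)}` (for `deg p = m`). -/
def dualNet (b m : ℕ) {d : ℕ} (g : Fin d → (ZMod b)[X]) (p : (ZMod b)[X]) : Set (Fin d → ℕ) :=
  {k | p ∣ ∑ j, trunc b m (k j) * g j}

open Classical in
/-- The quality measure `T_{α,η}(g, p)`: the sum of `r_{α,η}(k)⁻¹` over all nonzero
`k ∈ {0, …, b^m - 1}^d` in the dual net (for `deg p = m`). -/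
def truncQualityAlpha (b m : ℕ) (α : ℝ) (η : ℕ → ℝ) {d : ℕ} (g : Fin d → (ZMod b)[X])
    (p : (ZMod b)[X]) : ℝ :=
  ∑ k ∈ Fintype.piFinset (fun _ : Fin d => range (b ^ m)) with k ≠ 0 ∧ k ∈ dualNet b m g p,
    (weightedDecay b α η k)⁻¹

/-- The `α`-independent truncated quality measure `T_η(g, p)`, built with `r_{1,η}`. -/
def truncQuality (b m : ℕ) (η : ℕ → ℝ) {d : ℕ} (g : Fin d → (ZMod b)[X]) (p : (ZMod b)[X]) : ℝ :=
  truncQualityAlpha b m 1 η g p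

/-- The factor `1 + η (1 - b) (⌊log_b v_t(ℓ(x) q(x) / x^t)⌋ + 1)`. -/
def digitFactor (b : ℕ) [Fact b.Prime] (η : ℝ) (t l : ℕ) (q : (ZMod b)[X]) : ℝ :=
  1 + η * (1 - (b : ℝ)) * ((⌊Real.logb b (vFrac b t (natPoly b l * q) (X ^ t))⌋ : ℝ) + 1)

/-- The digit-wise quality function `h_{r,w,m,η}(q)`, which depends on the components `g j`,
`j < r`, found before. Components are numbered from `0`. -/
def digitQuality (b : ℕ) [Fact b.Prime] (m : ℕ) (η : ℕ → ℝ) (g : ℕ → (ZMod b)[X]) (r w : ℕ)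
    (q : (ZMod b)[X]) : ℝ :=
  ∑ t ∈ Icc w m, 1 / (b : ℝ) ^ (t - w) *
    ∑ l ∈ Icc 1 (b ^ t - 1) with ¬ b ∣ l,
      digitFactor b (η r) w l q * ∏ j ∈ range r, digitFactor b (η j) t l (g j)

/-- `G` records a run of the component-by-component digit-by-digit algorithm: `G r w` is the
polynomial `g_{r+1,w}`. The minimiser in the digit step need not be unique; every choice
among the minimisers is allowed. -/
structure IsCBCDBDRun (b : ℕ) [Fact b.Prime] (m d : ℕ) (η : ℕ → ℝ)
    (G : ℕ → ℕ → (ZMod b)[X]) : Prop where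
  first : G 0 m = 1
  init : ∀ r, 1 ≤ r → r < d → G r 1 = 1
  step : ∀ r, 1 ≤ r → r < d → ∀ w, 2 ≤ w → w ≤ m →
    ∃ c : ZMod b,
      (∀ c' : ZMod b,
        digitQuality b m η (fun j => G j m) r w (G r (w - 1) + C c * X ^ (w - 1)) ≤
          digitQuality b m η (fun j => G j m) r w (G r (w - 1) + C c' * X ^ (w - 1))) ∧
      G r w = G r (w - 1) + C c * X ^ (w - 1)

/-- `g = (g_1, …, g_d)` is a generating vector returned by the component-by-component
digit-by-digit algorithm with input `b, m, d, η`. -/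
def IsCBCDBDOutput (b : ℕ) [Fact b.Prime] (m : ℕ) {d : ℕ} (η : ℕ → ℝ)
    (g : Fin d → (ZMod b)[X]) : Prop :=
  ∃ G : ℕ → ℕ → (ZMod b)[X], IsCBCDBDRun b m d η G ∧ ∀ j : Fin d, g j = G j m

end PolyLattice

end

namespace PolyLattice

/-! ### Digit polynomials -/

/-! Write Z_t(q) for `leadingZeros t q`. The Walsh functions with index k < b^m, weighted by
1/r_1(k), sum to the explicit function `decaySum`: (b-1) Z_m, plus 1 when Z_m = m. Averaging ∏_j (1
+ η_j `decaySum`(l g_j)) over l < b^m therefore gives, by orthogonality of characters, a sum over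
the dual net, and this dominates ∏_j (1 + η_j) + T, the first product coming from k = 0
(`prod_one_add_add_truncQuality_le`). On the other side, l = 0 yields the first product of the
claimed bound, and the remaining l add up to `objective`.

It remains to see that `objective` is at most b^m ∏_j (1 + η_j), which the k = 0 term then cancels.
This is the method of conditional expectations: up to terms independent of the digit being chosen,
`digitQuality` is the mean of `objective` over uniformly random higher digits of the current
component. A minimising digit does no worse than the average (`condObjective_succ_le`), and the
initial mean costs a factor of at most 1 + η_r (`condObjective_one_le`).

The result is T ≤ b^{-m} ∏_j (1 + η_j((b-1)m + 1)); the second summand of the theorem is nonnegative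
and is merely added at the end. -/

theorem coeff_trunc (b m k i : ℕ) :
    (trunc b m k).coeff i = if i < m then ((k / b ^ i : ℕ) : ZMod b) else 0 := by
  simp [trunc, coeff_X_pow]

theorem coeff_natPoly (b : ℕ) [Fact b.Prime] (n i : ℕ) :
    (natPoly b n).coeff i = ((n / b ^ i : ℕ) : ZMod b) := by
  have hb : 1 < b := (Fact.out : b.Prime).one_lt
  simp only [natPoly, finsetSum_coeff, coeff_C_mul, coeff_X_pow, mul_ite, mul_one, mul_zero,
    sum_ite_eq, mem_range, ZMod.natCast_mod]
  split_ifs with h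
  · rfl
  · rw [Nat.div_eq_of_lt (Nat.lt_pow_of_log_lt hb (by omega)), Nat.cast_zero]

theorem trunc_eq_natPoly (b : ℕ) [Fact b.Prime] {m k : ℕ} (hk : k < b ^ m) :
    trunc b m k = natPoly b k := by
  have hb : 1 < b := (Fact.out : b.Prime).one_lt
  ext i
  rw [coeff_trunc, coeff_natPoly]
  split_ifs with h
  · rfl
  · rw [Nat.div_eq_of_lt (hk.trans_le (Nat.pow_le_pow_right hb.le (by omega))), Nat.cast_zero]

theorem natPoly_zero (b : ℕ) : natPoly b 0 = 0 := by simp [natPoly]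

theorem natPoly_mul_base (b : ℕ) [Fact b.Prime] (n : ℕ) :
    natPoly b (b * n) = X * natPoly b n := by
  have hb : 0 < b := (Fact.out : b.Prime).pos
  ext i
  cases i with
  | zero => simp [coeff_natPoly]
  | succ i =>
    rw [coeff_X_mul, coeff_natPoly, coeff_natPoly, pow_succ', Nat.mul_div_mul_left _ _ hb]

theorem coeff_zero_natPoly_ne_zero (b : ℕ) [Fact b.Prime] {l : ℕ} (hl : ¬ b ∣ l) :
    (natPoly b l).coeff 0 ≠ 0 := by
  rw [coeff_natPoly, pow_zero, Nat.div_one]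
  rwa [Ne, ZMod.natCast_eq_zero_iff]

theorem trunc_zero_left (b k : ℕ) : trunc b 0 k = 0 := by simp [trunc]

theorem trunc_succ_add (b : ℕ) [Fact b.Prime] (m k : ℕ) {c : ℕ} (hc : c < b) :
    trunc b (m + 1) (c + b * k) = C (c : ZMod b) + X * trunc b m k := by
  have hb : 0 < b := (Fact.out : b.Prime).pos
  ext i
  cases i with
  | zero => simp [coeff_trunc]
  | succ i =>
    rw [coeff_add, coeff_X_mul, coeff_trunc, coeff_trunc, coeff_C_succ, zero_add, pow_succ',
      ← Nat.div_div_eq_div_mul, Nat.add_mul_div_left _ _ hb, Nat.div_eq_of_lt hc, zero_add]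
    simp

theorem X_pow_dvd_trunc_iff (b : ℕ) [Fact b.Prime] {m k : ℕ} (hk : k < b ^ m) :
    X ^ m ∣ trunc b m k ↔ k = 0 := by
  have hb : 1 < b := (Fact.out : b.Prime).one_lt
  constructor
  · intro h
    rw [X_pow_dvd_iff] at h
    by_contra hk0
    have hlog : Nat.log b k < m := Nat.log_lt_of_lt_pow hk0 hk
    have h1 := h _ hlog
    rw [coeff_trunc, if_pos hlog, ZMod.natCast_eq_zero_iff] at h1
    have h2 : 0 < k / b ^ Nat.log b k :=
      Nat.div_pos (Nat.pow_log_le_self b hk0) (pow_pos (by omega) _)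
    have h3 : k / b ^ Nat.log b k < b := by
      rw [Nat.div_lt_iff_lt_mul (pow_pos (by omega) _), ← pow_succ']
      exact Nat.lt_pow_succ_log_self hb k
    exact absurd (Nat.le_of_dvd h2 h1) (by omega)
  · rintro rfl
    simp [trunc]

/-! ### Leading zeros -/

/-- The number of consecutive zeros among the coefficients of `x^{t-1}, x^{t-2}, …, x^0` in `q`,
counted from the coefficient of `x^{t-1}`. -/
def leadingZeros {b : ℕ} : ℕ → (ZMod b)[X] → ℕ
  | 0, _ => 0
  | t + 1, q => if q.coeff t = 0 then leadingZeros t q + 1 else 0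

theorem leadingZeros_succ {b : ℕ} (t : ℕ) (q : (ZMod b)[X]) :
    leadingZeros (t + 1) q = if q.coeff t = 0 then leadingZeros t q + 1 else 0 := rfl

theorem leadingZeros_le {b : ℕ} (t : ℕ) (q : (ZMod b)[X]) : leadingZeros t q ≤ t := by
  induction t with
  | zero => simp [leadingZeros]
  | succ t ih =>
    rw [leadingZeros]
    split_ifs <;> omega

theorem leadingZeros_eq_iff {b : ℕ} (t : ℕ) (q : (ZMod b)[X]) :
    leadingZeros t q = t ↔ X ^ t ∣ q := by
  rw [X_pow_dvd_iff]
  induction t with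
  | zero => simp [leadingZeros]
  | succ t ih =>
    rw [leadingZeros, Nat.forall_lt_succ_right]
    split_ifs with h
    · simp [h, ih]
    · simp [h]

theorem leadingZeros_congr {b : ℕ} {t : ℕ} {p q : (ZMod b)[X]}
    (h : ∀ i < t, p.coeff i = q.coeff i) : leadingZeros t p = leadingZeros t q := by
  induction t with
  | zero => rfl
  | succ t ih =>
    rw [leadingZeros, leadingZeros, h t (by omega), ih fun i hi => h i (by omega)]

/-- The nonzero coefficient that ends the run moves up together with the window. Without strictness
the count would become t + 1. -/
theorem leadingZeros_X_mul {b : ℕ} {t : ℕ} {q : (ZMod b)[X]} (h : leadingZeros t q < t) :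
    leadingZeros (t + 1) (X * q) = leadingZeros t q := by
  induction t with
  | zero => omega
  | succ t ih =>
    rw [leadingZeros] at h
    rw [leadingZeros_succ (t + 1), leadingZeros_succ t q, coeff_X_mul]
    split_ifs at h ⊢
    · rw [ih (by omega)]
    · rfl

theorem leadingZeros_one_eq_zero {b : ℕ} {q : (ZMod b)[X]} (h : q.coeff 0 ≠ 0) :
    leadingZeros 1 q = 0 := by
  simp [leadingZeros, h]

/-- X is prime and does not divide q, so X^t would have to divide the nonzero polynomial of l, whose
degree is below t. -/
theorem leadingZeros_natPoly_mul_lt (b : ℕ) [Fact b.Prime] {t l : ℕ} (hl : l ≠ 0)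
    (hlt : l < b ^ t) {q : (ZMod b)[X]} (hq : q.coeff 0 ≠ 0) :
    leadingZeros t (natPoly b l * q) < t := by
  refine lt_of_le_of_ne (leadingZeros_le _ _) fun h => hl ?_
  rw [leadingZeros_eq_iff] at h
  rw [← X_pow_dvd_trunc_iff b hlt, trunc_eq_natPoly b hlt]
  exact prime_X.pow_dvd_of_dvd_mul_right t (by rwa [X_dvd_iff]) h

/-! ### The digit factors -/

theorem coeff_toLaurentInv (b : ℕ) [Fact b.Prime] (q : (ZMod b)[X]) (n : ℕ) :
    (toLaurentInv b q).coeff (-(n : ℤ)) = q.coeff n := by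
  rw [toLaurentInv, eval₂_eq_sum_range, HahnSeries.coeff_sum]
  simp only [HahnSeries.single_pow, one_pow, HahnSeries.coeff_single, HahnSeries.C_apply,
    HahnSeries.single_mul_single, zero_add, mul_one, smul_neg, neg_inj, nsmul_eq_mul, Nat.cast_inj]
  simp only [sum_ite_eq, mem_range]
  split_ifs with h
  · rfl
  · rw [coeff_eq_zero_of_natDegree_lt (by omega)]

theorem vFrac_X_pow (b : ℕ) [Fact b.Prime] (t : ℕ) (q : (ZMod b)[X]) :
    vFrac b t q (X ^ t) =
      ∑ i ∈ Icc 1 t, ((q.coeff (t - i)).val : ℝ) * ((b : ℝ) ^ i)⁻¹ := by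
  rw [vFrac, vMap]
  have hX : toLaurentInv b (X ^ t) = HahnSeries.single (-(t : ℤ)) 1 := by
    simp [toLaurentInv, HahnSeries.single_pow]
  have hinv : (HahnSeries.single (-(t : ℤ)) (1 : ZMod b))⁻¹ = HahnSeries.single (t : ℤ) 1 := by
    rw [HahnSeries.inv_single, neg_neg, inv_one]
  refine sum_congr rfl fun i hi => ?_
  have hi' := mem_Icc.1 hi
  have h1 : (i : ℤ) = -((t - i : ℕ) : ℤ) + (t : ℤ) := by omega
  rw [hX, div_eq_mul_inv, hinv, h1, HahnSeries.coeff_mul_single_add, coeff_toLaurentInv, mul_one]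

theorem vFrac_X_pow_succ (b : ℕ) [Fact b.Prime] (t : ℕ) (q : (ZMod b)[X]) :
    vFrac b (t + 1) q (X ^ (t + 1)) =
      ((q.coeff t).val + vFrac b t q (X ^ t)) * (b : ℝ)⁻¹ := by
  rw [vFrac_X_pow, vFrac_X_pow, ← Finset.add_sum_Ioc_eq_sum_Icc (by omega), add_mul, sum_mul]
  congr 1
  · simp
  · have : Ioc 1 (t + 1) = (Icc 1 t).map (addRightEmbedding 1) := by
      rw [Finset.map_add_right_Icc]; rfl
    rw [this, sum_map]
    refine sum_congr rfl fun i _ => ?_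
    rw [addRightEmbedding_apply, Nat.add_sub_add_right, pow_succ, mul_inv, mul_assoc]

theorem vFrac_X_pow_nonneg (b : ℕ) [Fact b.Prime] (t : ℕ) (q : (ZMod b)[X]) :
    0 ≤ vFrac b t q (X ^ t) := by
  rw [vFrac_X_pow]
  positivity

theorem vFrac_X_pow_lt_one (b : ℕ) [Fact b.Prime] (t : ℕ) (q : (ZMod b)[X]) :
    vFrac b t q (X ^ t) < 1 := by
  have hb : (0 : ℝ) < b := by exact_mod_cast (Fact.out : b.Prime).pos
  induction t with
  | zero => rw [vFrac_X_pow]; simp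
  | succ t ih =>
    rw [vFrac_X_pow_succ, mul_inv_lt_iff₀ hb]
    have : ((q.coeff t).val : ℝ) + 1 ≤ b := by exact_mod_cast ZMod.val_lt (q.coeff t)
    linarith

/-- The first nonzero base-b digit of the value is in place Z + 1. The constant coefficient
guarantees that there is one, so the logarithm is never taken at 0. -/
theorem vFrac_X_pow_mem_Ico (b : ℕ) [Fact b.Prime] {q : (ZMod b)[X]} (hq : q.coeff 0 ≠ 0)
    (t : ℕ) : vFrac b (t + 1) q (X ^ (t + 1)) ∈
      Set.Ico (((b : ℝ) ^ (leadingZeros (t + 1) q + 1))⁻¹)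
        (((b : ℝ) ^ leadingZeros (t + 1) q)⁻¹) := by
  have hb : (0 : ℝ) < b := by exact_mod_cast (Fact.out : b.Prime).pos
  by_cases h : q.coeff t = 0
  · cases t with
    | zero => exact absurd h hq
    | succ t =>
      have ih := vFrac_X_pow_mem_Ico b hq t
      rw [leadingZeros, if_pos h, vFrac_X_pow_succ, h, ZMod.val_zero, Nat.cast_zero, zero_add]
      have hb' : (0 : ℝ) < (b : ℝ)⁻¹ := by positivity
      rw [pow_succ (b : ℝ) (leadingZeros (t + 1) q + 1), mul_inv]
      nth_rw 2 [pow_succ]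
      rw [mul_inv ((b : ℝ) ^ leadingZeros (t + 1) q)]
      exact ⟨mul_le_mul_of_nonneg_right ih.1 hb'.le, mul_lt_mul_of_pos_right ih.2 hb'⟩
  · rw [leadingZeros, if_neg h]
    refine ⟨?_, by simpa using vFrac_X_pow_lt_one b (t + 1) q⟩
    rw [vFrac_X_pow_succ, zero_add, pow_one]
    have h1 : (1 : ℝ) ≤ (q.coeff t).val := by
      exact_mod_cast Nat.one_le_iff_ne_zero.2 (by rwa [Ne, ZMod.val_eq_zero])
    have h2 := vFrac_X_pow_nonneg b t q
    exact le_mul_of_one_le_left (by positivity) (by linarith)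

theorem digitFactor_eq (b : ℕ) [Fact b.Prime] (η : ℝ) {t l : ℕ} (ht : 1 ≤ t) (hl : ¬ b ∣ l)
    {q : (ZMod b)[X]} (hq : q.coeff 0 ≠ 0) :
    digitFactor b η t l q = 1 + η * ((b - 1) * leadingZeros t (natPoly b l * q)) := by
  have hb : (1 : ℝ) < b := by exact_mod_cast (Fact.out : b.Prime).one_lt
  obtain ⟨t, rfl⟩ := Nat.exists_eq_add_of_le' ht
  have h0 : (natPoly b l * q).coeff 0 ≠ 0 := by
    rw [mul_coeff_zero]
    exact mul_ne_zero (coeff_zero_natPoly_ne_zero b hl) hq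
  obtain ⟨h1, h2⟩ := vFrac_X_pow_mem_Ico b h0 t
  have hpos : 0 < vFrac b (t + 1) (natPoly b l * q) (X ^ (t + 1)) :=
    lt_of_lt_of_le (by positivity) h1
  have hfl : ⌊Real.logb b (vFrac b (t + 1) (natPoly b l * q) (X ^ (t + 1)))⌋ =
      -((leadingZeros (t + 1) (natPoly b l * q) : ℤ) + 1) := by
    rw [Int.floor_eq_iff]
    constructor
    · rw [Real.le_logb_iff_rpow_le hb hpos, Real.rpow_intCast, zpow_neg]
      exact_mod_cast h1
    · rw [Real.logb_lt_iff_lt_rpow hb hpos]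
      push_cast
      rw [neg_add_rev, neg_add_cancel_comm, Real.rpow_neg (by linarith), Real.rpow_natCast]
      exact h2
  rw [digitFactor, hfl]
  push_cast
  ring

/-! ### Character sums -/

theorem sum_range_mul_eq {M : Type*} [AddCommMonoid M] (f : ℕ → M) (b N : ℕ) :
    ∑ k ∈ range (b * N), f k = ∑ k ∈ range N, ∑ c ∈ range b, f (c + b * k) := by
  induction N with
  | zero => simp
  | succ N ih =>
    rw [Nat.mul_succ, sum_range_add, sum_range_succ, ih]
    simp [add_comm]

theorem sum_range_natCast_zmod {M : Type*} [AddCommMonoid M] (b : ℕ) [NeZero b]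
    (f : ZMod b → M) : ∑ c ∈ range b, f c = ∑ x, f x := by
  refine sum_nbij' (fun c => (c : ZMod b)) ZMod.val ?_ ?_ ?_ ?_ ?_
  · simp
  · intro x _; simpa using ZMod.val_lt x
  · intro c hc; exact ZMod.val_cast_of_lt (mem_range.1 hc)
  · intro x _; exact ZMod.natCast_zmod_val x
  · simp

theorem sum_range_stdAddChar_mul (b : ℕ) [Fact b.Prime] (y : ZMod b) :
    ∑ c ∈ range b, ZMod.stdAddChar ((c : ZMod b) * y) = if y = 0 then (b : ℂ) else 0 := by
  rw [sum_range_natCast_zmod b fun x => ZMod.stdAddChar (x * y),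
    AddChar.sum_mulShift y (ZMod.isPrimitive_stdAddChar b), ZMod.card]
  split_ifs <;> simp

/-- The value of the `k`-th Walsh function at `v_m (q(x) / x^m)`. -/
noncomputable def walsh (b : ℕ) [Fact b.Prime] (m k : ℕ) (q : (ZMod b)[X]) : ℂ :=
  ZMod.stdAddChar ((trunc b m k * q).coeff (m - 1))

/-- The lowest digit of k is paired with the top coefficient of q. Peeling off both is the induction
step for all Walsh sums. -/
theorem walsh_succ (b : ℕ) [Fact b.Prime] (m k : ℕ) {c : ℕ} (hc : c < b) (q : (ZMod b)[X]) :
    walsh b (m + 1) (c + b * k) q =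
      ZMod.stdAddChar ((c : ZMod b) * q.coeff m) * walsh b m k q := by
  rw [walsh, walsh, ← AddChar.map_add_eq_mul, trunc_succ_add b m k hc, Nat.add_sub_cancel,
    add_mul, coeff_add, coeff_C_mul, mul_assoc]
  congr 2
  cases m with
  -- For m = 0 the truncation vanishes, so the truncated index m - 1 = 0 does no harm.
  | zero => simp [trunc_zero_left]
  | succ m => rw [coeff_X_mul, Nat.add_sub_cancel]

theorem walsh_zero_right (b : ℕ) [Fact b.Prime] (m : ℕ) (q : (ZMod b)[X]) :
    walsh b m 0 q = 1 := by
  simp [walsh, trunc]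

theorem sum_walsh (b : ℕ) [Fact b.Prime] (m : ℕ) (q : (ZMod b)[X]) :
    ∑ k ∈ range (b ^ m), walsh b m k q = if leadingZeros m q = m then (b : ℂ) ^ m else 0 := by
  induction m with
  | zero => simp [leadingZeros, walsh_zero_right]
  | succ m ih =>
    rw [pow_succ', sum_range_mul_eq]
    have : ∀ k ∈ range (b ^ m), ∑ c ∈ range b, walsh b (m + 1) (c + b * k) q =
        (if q.coeff m = 0 then (b : ℂ) else 0) * walsh b m k q := by
      intro k _
      rw [← sum_range_stdAddChar_mul, sum_mul]
      exact sum_congr rfl fun c hc => walsh_succ b m k (mem_range.1 hc) q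
    rw [sum_congr rfl this, ← mul_sum, ih, leadingZeros]
    by_cases h : q.coeff m = 0
    · simp [h, pow_succ']
    · simp [h]

theorem decay_one (b k : ℕ) : decay b 1 k = (b : ℝ) ^ Nat.log b k := by
  rw [decay, one_mul, Real.rpow_natCast]
  split_ifs with h
  · simp [h]
  · rfl

theorem decay_one_succ (b : ℕ) [Fact b.Prime] {c k : ℕ} (hc : c < b) :
    (decay b 1 (c + b * k))⁻¹ = if k = 0 then 1 else (b : ℝ)⁻¹ * (decay b 1 k)⁻¹ := by
  have hb : 1 < b := (Fact.out : b.Prime).one_lt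
  rw [decay_one, decay_one]
  split_ifs with h
  · subst h
    simp [Nat.log_of_lt hc]
  · have h1 : Nat.log b (c + b * k) = Nat.log b k + 1 := by
      have h2 : b ≤ c + b * k :=
        (Nat.le_mul_of_pos_right b (Nat.pos_of_ne_zero h)).trans (Nat.le_add_left _ _)
      rw [Nat.log_of_one_lt_of_le hb h2, Nat.add_mul_div_left _ _ (by omega),
        Nat.div_eq_of_lt hc, zero_add]
    rw [h1, pow_succ', mul_inv]

/-- The value of `∑_{k < b^m} wal_k / r_1(k)` at `v_m (q(x) / x^m)`. -/
def decaySum {b : ℕ} (m : ℕ) (q : (ZMod b)[X]) : ℝ :=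
  (b - 1) * leadingZeros m q + if leadingZeros m q = m then 1 else 0

theorem sum_decay_walsh (b : ℕ) [Fact b.Prime] (m : ℕ) (q : (ZMod b)[X]) :
    ∑ k ∈ range (b ^ m), ((decay b 1 k)⁻¹ : ℝ) * walsh b m k q = (decaySum m q : ℝ) := by
  have hb : (b : ℂ) ≠ 0 := by exact_mod_cast (Fact.out : b.Prime).ne_zero
  induction m with
  | zero => simp [leadingZeros, decaySum, walsh_zero_right, decay_one]
  | succ m ih =>
    have hpos : 0 < b ^ m := pow_pos (Fact.out : b.Prime).pos m
    rw [pow_succ', sum_range_mul_eq]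
    set s : ℂ := if q.coeff m = 0 then (b : ℂ) else 0 with hs
    -- At k = 0 the weight stays 1 instead of shrinking by b; the extra 1 - b⁻¹ corrects this.
    have : ∀ k ∈ range (b ^ m), ∑ c ∈ range b,
        ((decay b 1 (c + b * k))⁻¹ : ℝ) * walsh b (m + 1) (c + b * k) q =
        s * ((b : ℂ)⁻¹ * (((decay b 1 k)⁻¹ : ℝ) * walsh b m k q) +
          if k = 0 then 1 - (b : ℂ)⁻¹ else 0) := by
      intro k _
      rw [hs, ← sum_range_stdAddChar_mul, sum_mul]
      refine sum_congr rfl fun c hc => ?_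
      rw [walsh_succ b m k (mem_range.1 hc), decay_one_succ b (mem_range.1 hc)]
      split_ifs with h
      · subst h
        simp [walsh_zero_right, decay_one]
      · push_cast
        ring
    rw [sum_congr rfl this, ← mul_sum, sum_add_distrib, ← mul_sum, ih, sum_ite_eq',
      if_pos (mem_range.2 hpos), hs, decaySum, decaySum, leadingZeros]
    by_cases h : q.coeff m = 0
    · simp only [h, if_true, add_left_inj]
      push_cast
      field_simp
      ring
    · simp [h]

/-- The `k`-th Walsh coefficient of `1 + η ∑_{k < b^m} wal_k / r_1(k)`. -/
noncomputable def walshCoeff (b : ℕ) (η : ℝ) (k : ℕ) : ℝ :=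
  (if k = 0 then 1 else 0) + η * (decay b 1 k)⁻¹

theorem walshCoeff_zero (b : ℕ) (η : ℝ) : walshCoeff b η 0 = 1 + η := by
  simp [walshCoeff, decay_one]

theorem one_add_decaySum_eq (b : ℕ) [Fact b.Prime] (m : ℕ) (η : ℝ) (q : (ZMod b)[X]) :
    ((1 + η * decaySum m q : ℝ) : ℂ) =
      ∑ k ∈ range (b ^ m), (walshCoeff b η k : ℂ) * walsh b m k q := by
  have hpos : 0 < b ^ m := pow_pos (Fact.out : b.Prime).pos m
  have h1 : ∀ k ∈ range (b ^ m), (walshCoeff b η k : ℂ) * walsh b m k q =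
      (if k = 0 then 1 else 0) + η * (((decay b 1 k)⁻¹ : ℝ) * walsh b m k q) := by
    intro k _
    rw [walshCoeff]
    split_ifs with h
    · subst h
      simp [walsh_zero_right]
    · push_cast
      ring
  rw [sum_congr rfl h1, sum_add_distrib, ← mul_sum, sum_decay_walsh, sum_ite_eq',
    if_pos (mem_range.2 hpos)]
  push_cast
  rfl

/-- The pairing depends only on the products of the polynomials of k_j, l and g_j, so l can take
over the role of index. Summing over l then detects the dual net. -/
theorem prod_walsh (b : ℕ) [Fact b.Prime] {m l d : ℕ} (hl : l < b ^ m) (k : Fin d → ℕ)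
    (g : Fin d → (ZMod b)[X]) :
    ∏ j, walsh b m (k j) (natPoly b l * g j) = walsh b m l (∑ j, trunc b m (k j) * g j) := by
  rw [walsh, trunc_eq_natPoly b hl, mul_sum, finsetSum_coeff]
  refine (prod_congr rfl fun j _ => ?_).trans
    (map_prod (ZMod.stdAddChar (N := b)).toMonoidHom
      (fun j => Multiplicative.ofAdd ((natPoly b l * (trunc b m (k j) * g j)).coeff (m - 1)))
      univ).symm
  rw [walsh, mul_left_comm]
  rfl

/-! ### The quality measure as a sum over the point set -/

open Classical in
theorem sum_prod_decaySum (b : ℕ) [Fact b.Prime] (m : ℕ) {d : ℕ} (η : Fin d → ℝ)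
    (g : Fin d → (ZMod b)[X]) :
    ∑ l ∈ range (b ^ m), ∏ j, (1 + η j * decaySum m (natPoly b l * g j)) =
      (b : ℝ) ^ m * ∑ k ∈ Fintype.piFinset (fun _ : Fin d => range (b ^ m)) with
        k ∈ dualNet b m g (X ^ m), ∏ j, walshCoeff b (η j) (k j) := by
  apply Complex.ofReal_injective
  rw [Complex.ofReal_sum]
  have h1 : ∀ l ∈ range (b ^ m),
      ((∏ j, (1 + η j * decaySum m (natPoly b l * g j)) : ℝ) : ℂ) =
      ∑ k ∈ Fintype.piFinset (fun _ : Fin d => range (b ^ m)),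
        ((∏ j, walshCoeff b (η j) (k j) : ℝ) : ℂ) *
          walsh b m l (∑ j, trunc b m (k j) * g j) := by
    intro l hl
    rw [Complex.ofReal_prod, prod_congr rfl fun j _ => one_add_decaySum_eq b m (η j) _,
      prod_univ_sum]
    refine sum_congr rfl fun k _ => ?_
    rw [prod_mul_distrib, prod_walsh b (mem_range.1 hl), Complex.ofReal_prod]
  rw [sum_congr rfl h1, sum_comm, sum_filter, Complex.ofReal_mul, Complex.ofReal_sum, mul_sum]
  refine sum_congr rfl fun k _ => ?_
  rw [← mul_sum, sum_walsh]
  have hiff : leadingZeros m (∑ j, trunc b m (k j) * g j) = m ↔ k ∈ dualNet b m g (X ^ m) :=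
    leadingZeros_eq_iff _ _
  by_cases h : k ∈ dualNet b m g (X ^ m)
  · rw [if_pos h, if_pos (hiff.2 h), mul_comm, Complex.ofReal_pow, Complex.ofReal_natCast]
  · rw [if_neg h, if_neg (mt hiff.1 h), mul_zero, Complex.ofReal_zero, mul_zero]

/-- The factors agree where k_j ≠ 0; where k_j = 0 they are 1 and 1 + η_j. -/
theorem inv_weightedDecay_le (b : ℕ) [Fact b.Prime] {d : ℕ} {η : ℕ → ℝ} (hη : ∀ j, 0 < η j)
    (k : Fin d → ℕ) : (weightedDecay b 1 η k)⁻¹ ≤ ∏ j : Fin d, walshCoeff b (η j) (k j) := by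
  have hb : (0 : ℝ) < b := by exact_mod_cast (Fact.out : b.Prime).pos
  rw [weightedDecay, mul_inv, inv_inv, prod_filter, ← prod_inv_distrib, ← prod_mul_distrib]
  refine prod_le_prod (fun j _ => ?_) fun j _ => ?_
  · have := hη j
    rw [decay_one]
    positivity
  · have := hη j
    by_cases h : k j = 0
    · simp [h, walshCoeff_zero, decay_one, this.le]
    · simp [h, walshCoeff]

theorem prod_one_add_add_truncQuality_le (b : ℕ) [Fact b.Prime] (m : ℕ) {d : ℕ} {η : ℕ → ℝ}
    (hη : ∀ j, 0 < η j) (g : Fin d → (ZMod b)[X]) :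
    (b : ℝ) ^ m * (∏ j ∈ range d, (1 + η j) + truncQuality b m η g (X ^ m)) ≤
      ∑ l ∈ range (b ^ m), ∏ j : Fin d, (1 + η j * decaySum m (natPoly b l * g j)) := by
  classical
  rw [sum_prod_decaySum b m (fun j : Fin d => η j) g]
  refine mul_le_mul_of_nonneg_left ?_ (by positivity)
  have hmem : (0 : Fin d → ℕ) ∈ {k ∈ Fintype.piFinset (fun _ : Fin d => range (b ^ m)) |
      k ∈ dualNet b m g (X ^ m)} := by
    simp [dualNet, trunc, (Fact.out : b.Prime).pos]
  rw [← add_sum_erase _ _ hmem]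
  refine add_le_add ?_ ?_
  · rw [prod_range]
    simp [walshCoeff_zero]
  · rw [truncQuality, truncQualityAlpha]
    refine le_of_eq_of_le (sum_congr ?_ fun _ _ => rfl)
      (sum_le_sum fun k _ => inv_weightedDecay_le b hη k)
    ext k
    simp only [mem_filter, mem_erase]
    tauto

/-- The sum over all `0 < l < b^m` of the product of the factors `1 + η_j (b-1) Z_j(l)`, where
`Z_j(l)` is the number of leading zeros of `l g_j` modulo `x^m`, arranged by the power of `b`
that divides `l`. -/
noncomputable def objective (b m : ℕ) (η : ℕ → ℝ) (g : ℕ → (ZMod b)[X]) (d : ℕ) : ℝ :=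
  ∑ t ∈ Icc 1 m, ∑ l ∈ Icc 1 (b ^ t - 1) with ¬ b ∣ l,
    ∏ j ∈ range d, (1 + η j * ((b - 1) * leadingZeros t (natPoly b l * g j)))

theorem sum_Icc_eq_objective (b : ℕ) [Fact b.Prime] (m d : ℕ) (η : ℕ → ℝ)
    {g : ℕ → (ZMod b)[X]} (hg : ∀ j < d, (g j).coeff 0 ≠ 0) :
    ∑ l ∈ Icc 1 (b ^ m - 1), ∏ j ∈ range d,
      (1 + η j * ((b - 1) * leadingZeros m (natPoly b l * g j))) = objective b m η g d := by
  have hb : 0 < b := (Fact.out : b.Prime).pos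
  rw [objective]
  induction m with
  | zero => simp
  | succ m ih =>
    rw [sum_Icc_succ_top (by omega), ← ih,
      ← sum_filter_not_add_sum_filter (Icc 1 (b ^ (m + 1) - 1)) (fun l => b ∣ l), add_comm]
    congr 1
    symm
    -- The multiples of b below b^(m+1) are b l with l < b^m, and the resulting factor X leaves the
    -- leading zeros unchanged.
    refine sum_bij (fun l _ => b * l) ?_ ?_ ?_ ?_
    · intro l hl
      rw [mem_Icc] at hl
      simp only [mem_filter, mem_Icc, dvd_mul_right, and_true]
      have h1 : b * (l + 1) ≤ b * b ^ m := Nat.mul_le_mul_left b (by omega)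
      have h2 : 1 ≤ b * l := Nat.mul_pos hb hl.1
      rw [pow_succ']
      rw [mul_add] at h1
      omega
    · intro l _ l' _ h
      exact Nat.eq_of_mul_eq_mul_left hb h
    · intro l hl
      simp only [mem_filter, mem_Icc] at hl
      obtain ⟨⟨h1, h2⟩, l', rfl⟩ := hl
      refine ⟨l', ?_, rfl⟩
      have h3 : l' < b ^ m := by
        refine Nat.lt_of_mul_lt_mul_left (a := b) ?_
        rw [← pow_succ']
        omega
      have h4 : l' ≠ 0 := by rintro rfl; simp at h1
      rw [mem_Icc]
      omega
    · intro l hl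
      rw [mem_Icc] at hl
      refine prod_congr rfl fun j hj => ?_
      rw [natPoly_mul_base, mul_assoc, leadingZeros_X_mul]
      exact leadingZeros_natPoly_mul_lt b (by omega) (by omega) (hg j (mem_range.1 hj))

theorem sum_prod_decaySum_eq_objective (b : ℕ) [Fact b.Prime] (m d : ℕ) (η : ℕ → ℝ)
    {g : ℕ → (ZMod b)[X]} (hg : ∀ j < d, (g j).coeff 0 ≠ 0) :
    ∑ l ∈ range (b ^ m), ∏ j : Fin d, (1 + η j * decaySum m (natPoly b l * g j)) =
      ∏ j ∈ range d, (1 + η j * ((b - 1) * m + 1)) + objective b m η g d := by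
  have hpos : 0 < b ^ m := pow_pos (Fact.out : b.Prime).pos m
  have hr : range (b ^ m) = insert 0 (Icc 1 (b ^ m - 1)) := by
    ext l
    simp only [mem_range, mem_insert, mem_Icc]
    omega
  rw [hr, sum_insert (by simp), ← sum_Icc_eq_objective b m d η hg]
  congr 1
  · have h0 : leadingZeros m (0 : (ZMod b)[X]) = m :=
      (leadingZeros_eq_iff _ _).2 (dvd_zero _)
    rw [prod_range]
    simp [natPoly_zero, decaySum, h0]
  · refine sum_congr rfl fun l hl => ?_
    rw [mem_Icc] at hl
    rw [prod_range]
    refine prod_congr rfl fun j _ => ?_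
    rw [decaySum, if_neg, add_zero]
    exact (leadingZeros_natPoly_mul_lt b (by omega) (by omega) (hg j j.2)).ne

/-- For the single component 1 the dual net meets the box only in 0, so the full sum over l equals
b^m (1 + η_0); dropping l = 0 gives the bound. -/
theorem objective_one_le (b : ℕ) [Fact b.Prime] (m : ℕ) {η : ℕ → ℝ} (hη : 0 < η 0)
    {g : ℕ → (ZMod b)[X]} (hg : g 0 = 1) :
    objective b m η g 1 ≤ (b : ℝ) ^ m * (1 + η 0) := by
  classical
  have hb : (1 : ℝ) < b := by exact_mod_cast (Fact.out : b.Prime).one_lt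
  have hpos : 0 < b ^ m := pow_pos (Fact.out : b.Prime).pos m
  have h1 := sum_prod_decaySum_eq_objective b m 1 η (g := g) (by simp [hg])
  have h2 := sum_prod_decaySum b m (fun j : Fin 1 => η j) (fun j => g j)
  have h3 : {k ∈ Fintype.piFinset (fun _ : Fin 1 => range (b ^ m)) |
      k ∈ dualNet b m (fun j : Fin 1 => g j) (X ^ m)} = {0} := by
    ext k
    simp only [mem_filter, Fintype.mem_piFinset, mem_range, dualNet, Set.mem_ofPred_eq,
      Fin.sum_univ_one, Fin.val_zero, hg, mul_one, mem_singleton, funext_iff, Fin.forall_fin_one,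
      Pi.zero_apply]
    constructor
    · rintro ⟨h, h'⟩
      exact (X_pow_dvd_trunc_iff b h).1 h'
    · intro h
      rw [X_pow_dvd_trunc_iff b (by omega)]
      exact ⟨by omega, h⟩
  rw [h3, sum_singleton] at h2
  simp only [Fin.prod_univ_one, Fin.val_zero, Pi.zero_apply, walshCoeff_zero] at h1 h2
  rw [h2, prod_range_one] at h1
  have h4 : 0 ≤ η 0 * (((b : ℝ) - 1) * m + 1) := by
    have : (0 : ℝ) ≤ b - 1 := by linarith
    positivity
  linarith

/-! ### The digit-by-digit search as a method of conditional expectations -/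

theorem coeff_natPoly_mul_add_of_lt {b : ℕ} (l : ℕ) (q : (ZMod b)[X]) (c : ZMod b) {w i : ℕ}
    (hi : i < w) :
    (natPoly b l * (q + C c * X ^ w)).coeff i = (natPoly b l * q).coeff i := by
  rw [mul_add, ← mul_assoc, coeff_add, coeff_mul_X_pow', if_neg (by omega), add_zero]

theorem coeff_natPoly_mul_add_self {b : ℕ} (l : ℕ) (q : (ZMod b)[X]) (c : ZMod b) (w : ℕ) :
    (natPoly b l * (q + C c * X ^ w)).coeff w =
      (natPoly b l * q).coeff w + (natPoly b l).coeff 0 * c := by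
  rw [mul_add, ← mul_assoc, coeff_add, coeff_mul_X_pow', if_pos le_rfl, Nat.sub_self,
    coeff_mul_C]

theorem leadingZeros_natPoly_mul_add {b : ℕ} (l : ℕ) (q : (ZMod b)[X]) (c : ZMod b) {t w : ℕ}
    (ht : t ≤ w) :
    leadingZeros t (natPoly b l * (q + C c * X ^ w)) = leadingZeros t (natPoly b l * q) :=
  leadingZeros_congr fun _ hi => coeff_natPoly_mul_add_of_lt l q c (hi.trans_le ht)

/-- As l has an invertible constant coefficient, exactly one digit c kills the coefficient of x^w
and prolongs the run; every other digit gives 0. -/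
theorem sum_leadingZeros_succ (b : ℕ) [Fact b.Prime] (w : ℕ) {l : ℕ} (hl : ¬ b ∣ l)
    (q : (ZMod b)[X]) :
    ∑ c : ZMod b, leadingZeros (w + 1) (natPoly b l * (q + C c * X ^ w)) =
      leadingZeros w (natPoly b l * q) + 1 := by
  have hl0 := coeff_zero_natPoly_ne_zero b hl
  have h (c : ZMod b) : leadingZeros (w + 1) (natPoly b l * (q + C c * X ^ w)) =
      if c = -(natPoly b l * q).coeff w / (natPoly b l).coeff 0 then
        leadingZeros w (natPoly b l * q) + 1 else 0 := by
    rw [leadingZeros, coeff_natPoly_mul_add_self, leadingZeros_natPoly_mul_add l q c le_rfl]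
    refine if_congr ?_ rfl rfl
    rw [eq_div_iff hl0, add_comm, ← eq_neg_iff_add_eq_zero, mul_comm]
  simp [h]

/-- The mean of `1 + η (b-1) Z_t` over the digits `w, …, t-1` of a component of the generating
vector, where `Z_t` counts leading zeros and `q` is the product with the lower digits. -/
noncomputable def condFactor {b : ℕ} (η : ℝ) (w t : ℕ) (q : (ZMod b)[X]) : ℝ :=
  (1 + η) * (1 - ((b : ℝ) ^ (t - w))⁻¹) +
    ((b : ℝ) ^ (t - w))⁻¹ * (1 + η * ((b - 1) * leadingZeros (min t w) q))

/-- The mean of Z_{w+1} is (Z_w + 1)/b. The fixed point of this recursion is 1/(b-1), whence the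
limit value 1 + η and the rate b^{-(t-w)} in `condFactor`. For t ≤ w nothing is random any more. -/
theorem sum_condFactor_succ (b : ℕ) [Fact b.Prime] (η : ℝ) (w t : ℕ) {l : ℕ} (hl : ¬ b ∣ l)
    (q : (ZMod b)[X]) :
    ∑ c : ZMod b, condFactor η (w + 1) t (natPoly b l * (q + C c * X ^ w)) =
      b * condFactor η w t (natPoly b l * q) := by
  have hb : (b : ℝ) ≠ 0 := by exact_mod_cast (Fact.out : b.Prime).ne_zero
  rcases le_or_gt t w with h | h
  · simp only [condFactor, min_eq_left h, min_eq_left (h.trans w.le_succ),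
      leadingZeros_natPoly_mul_add l q _ h, sum_const, card_univ, ZMod.card, nsmul_eq_mul,
      Nat.sub_eq_zero_of_le h, Nat.sub_eq_zero_of_le (h.trans w.le_succ)]
  · obtain ⟨s, rfl⟩ := Nat.exists_eq_add_of_le h
    have h1 : ∑ c : ZMod b, (leadingZeros (w + 1) (natPoly b l * (q + C c * X ^ w)) : ℝ) =
        leadingZeros w (natPoly b l * q) + 1 := by
      exact_mod_cast sum_leadingZeros_succ b w hl q
    simp only [condFactor, Nat.succ_eq_add_one, min_eq_right (Nat.le_add_right (w + 1) s),
      min_eq_right h.le, sum_add_distrib, sum_const, card_univ, ZMod.card, nsmul_eq_mul,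
      ← mul_sum, h1, mul_one]
    rw [show w + 1 + s - (w + 1) = s by omega, show w + 1 + s - w = s + 1 by omega, pow_succ]
    field_simp
    ring

/-- The mean of `objective b m η g (r + 1)` over the digits from `w` on of the component `r`,
whose lower digits are those of `q`. -/
noncomputable def condObjective (b m : ℕ) (η : ℕ → ℝ) (g : ℕ → (ZMod b)[X]) (r w : ℕ)
    (q : (ZMod b)[X]) : ℝ :=
  ∑ t ∈ Icc 1 m, ∑ l ∈ Icc 1 (b ^ t - 1) with ¬ b ∣ l,
    (∏ j ∈ range r, (1 + η j * ((b - 1) * leadingZeros t (natPoly b l * g j)))) *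
      condFactor (η r) w t (natPoly b l * q)

theorem sum_condObjective_succ (b : ℕ) [Fact b.Prime] (m : ℕ) (η : ℕ → ℝ)
    (g : ℕ → (ZMod b)[X]) (r w : ℕ) (q : (ZMod b)[X]) :
    ∑ c : ZMod b, condObjective b m η g r (w + 1) (q + C c * X ^ w) =
      b * condObjective b m η g r w q := by
  simp only [condObjective]
  rw [sum_comm, mul_sum]
  refine sum_congr rfl fun t _ => ?_
  rw [sum_comm, mul_sum]
  refine sum_congr rfl fun l hl => ?_
  rw [← mul_sum, sum_condFactor_succ b (η r) w t (mem_filter.1 hl).2]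
  ring

/-- The part of `condObjective` that does not depend on the digits from `w - 1` on. -/
noncomputable def condObjectiveRest (b m : ℕ) (η : ℕ → ℝ) (g : ℕ → (ZMod b)[X]) (r w : ℕ)
    (q : (ZMod b)[X]) : ℝ :=
  ∑ t ∈ Icc 1 m, ∑ l ∈ Icc 1 (b ^ t - 1) with ¬ b ∣ l,
    (∏ j ∈ range r, (1 + η j * ((b - 1) * leadingZeros t (natPoly b l * g j)))) *
      if w ≤ t then (1 + η r) * (1 - ((b : ℝ) ^ (t - w))⁻¹)
      else 1 + η r * ((b - 1) * leadingZeros t (natPoly b l * q))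

/-- The weight 1/b^(t-w) in `digitQuality` is exactly the coefficient with which Z_w enters
`condFactor` when t ≥ w. Thus minimising `digitQuality` over a digit minimises the conditional mean.
-/
theorem condObjective_eq (b : ℕ) [Fact b.Prime] (m : ℕ) (η : ℕ → ℝ) {g : ℕ → (ZMod b)[X]}
    {r w : ℕ} (hw : 1 ≤ w) (hg : ∀ j < r, (g j).coeff 0 ≠ 0) {q : (ZMod b)[X]}
    (hq : q.coeff 0 ≠ 0) :
    condObjective b m η g r w q =
      condObjectiveRest b m η g r w q + digitQuality b m η g r w q := by
  have hIcc : Icc w m = {t ∈ Icc 1 m | w ≤ t} := by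
    ext t
    simp only [mem_Icc, mem_filter]
    omega
  rw [condObjective, condObjectiveRest, digitQuality, hIcc, sum_filter, ← sum_add_distrib]
  refine sum_congr rfl fun t ht => ?_
  have ht1 := (mem_Icc.1 ht).1
  split_ifs with h
  · rw [mul_sum, ← sum_add_distrib]
    refine sum_congr rfl fun l hl => ?_
    have hbl := (mem_filter.1 hl).2
    rw [prod_congr rfl fun j hj => digitFactor_eq b (η j) ht1 hbl (hg j (mem_range.1 hj)),
      digitFactor_eq b (η r) hw hbl hq, condFactor, min_eq_right h]
    ring
  · rw [add_zero]
    refine sum_congr rfl fun l _ => ?_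
    rw [condFactor, min_eq_left (by omega), Nat.sub_eq_zero_of_le (by omega)]
    simp

theorem condObjectiveRest_add (b m : ℕ) (η : ℕ → ℝ) (g : ℕ → (ZMod b)[X]) (r w : ℕ)
    (q : (ZMod b)[X]) (c : ZMod b) :
    condObjectiveRest b m η g r (w + 1) (q + C c * X ^ w) =
      condObjectiveRest b m η g r (w + 1) q := by
  refine sum_congr rfl fun t _ => sum_congr rfl fun l _ => ?_
  split_ifs with h
  · rfl
  · rw [leadingZeros_natPoly_mul_add l q c (by omega)]

theorem condObjective_succ_le (b : ℕ) [Fact b.Prime] (m : ℕ) (η : ℕ → ℝ) {g : ℕ → (ZMod b)[X]}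
    {r w : ℕ} (hw : 1 ≤ w) (hg : ∀ j < r, (g j).coeff 0 ≠ 0) {q : (ZMod b)[X]}
    (hq : q.coeff 0 ≠ 0) {c : ZMod b}
    (hc : ∀ c' : ZMod b, digitQuality b m η g r (w + 1) (q + C c * X ^ w) ≤
      digitQuality b m η g r (w + 1) (q + C c' * X ^ w)) :
    condObjective b m η g r (w + 1) (q + C c * X ^ w) ≤ condObjective b m η g r w q := by
  have hb : (0 : ℝ) < b := by exact_mod_cast (Fact.out : b.Prime).pos
  have hq' (c' : ZMod b) : (q + C c' * X ^ w).coeff 0 ≠ 0 := by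
    rwa [coeff_add, coeff_mul_X_pow', if_neg (by omega), add_zero]
  refine le_of_mul_le_mul_left ?_ hb
  rw [← sum_condObjective_succ b m η g r w q]
  have h (c' : ZMod b) : condObjective b m η g r (w + 1) (q + C c * X ^ w) ≤
      condObjective b m η g r (w + 1) (q + C c' * X ^ w) := by
    rw [condObjective_eq b m η (by omega) hg (hq' c),
      condObjective_eq b m η (by omega) hg (hq' c'), condObjectiveRest_add, condObjectiveRest_add]
    linarith [hc c']
  simpa using sum_le_sum fun c' (_ : c' ∈ univ) => h c'

theorem condObjective_self (b m : ℕ) (η : ℕ → ℝ) (g : ℕ → (ZMod b)[X]) (r : ℕ) :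
    condObjective b m η g r m (g r) = objective b m η g (r + 1) := by
  refine sum_congr rfl fun t ht => sum_congr rfl fun l _ => ?_
  have ht := (mem_Icc.1 ht).2
  rw [prod_range_succ, condFactor, min_eq_left ht, Nat.sub_eq_zero_of_le ht]
  simp

/-- For b ∤ l the start polynomial 1 has Z_1 = 0, so the mean factor is 1 + η_r - η_r b^{-(t-1)}. -/
theorem condObjective_one_le (b : ℕ) [Fact b.Prime] (m : ℕ) {η : ℕ → ℝ} (hη : ∀ j, 0 < η j)
    (g : ℕ → (ZMod b)[X]) (r : ℕ) :
    condObjective b m η g r 1 1 ≤ (1 + η r) * objective b m η g r := by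
  have hb : (1 : ℝ) < b := by exact_mod_cast (Fact.out : b.Prime).one_lt
  have hb' : (0 : ℝ) ≤ b - 1 := by linarith
  rw [condObjective, objective, mul_sum]
  refine sum_le_sum fun t ht => ?_
  rw [mul_sum]
  refine sum_le_sum fun l hl => ?_
  rw [mul_comm]
  refine mul_le_mul_of_nonneg_right ?_ (prod_nonneg fun j _ => ?_)
  · have h0 := coeff_zero_natPoly_ne_zero b (mem_filter.1 hl).2
    rw [condFactor, min_eq_right (mem_Icc.1 ht).1, mul_one, leadingZeros_one_eq_zero h0]
    have h1 : 0 ≤ ((b : ℝ) ^ (t - 1))⁻¹ := by positivity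
    have h2 := mul_nonneg (hη r).le h1
    push_cast
    linarith
  · have := hη j
    positivity

/-! ### Runs of the algorithm -/

theorem digitQuality_congr (b : ℕ) [Fact b.Prime] (m : ℕ) (η : ℕ → ℝ) {g g' : ℕ → (ZMod b)[X]}
    {r : ℕ} (h : ∀ j < r, g j = g' j) (w : ℕ) (q : (ZMod b)[X]) :
    digitQuality b m η g r w q = digitQuality b m η g' r w q := by
  refine sum_congr rfl fun t _ => congrArg _ <| sum_congr rfl fun l _ => congrArg _ <|
    prod_congr rfl fun j hj => ?_
  rw [h j (mem_range.1 hj)]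

theorem exists_component (b : ℕ) [Fact b.Prime] (m : ℕ) (η : ℕ → ℝ) (g : ℕ → (ZMod b)[X])
    (r : ℕ) : ∃ q : ℕ → (ZMod b)[X], q 1 = 1 ∧ ∀ w, 2 ≤ w → ∃ c : ZMod b,
      (∀ c' : ZMod b, digitQuality b m η g r w (q (w - 1) + C c * X ^ (w - 1)) ≤
        digitQuality b m η g r w (q (w - 1) + C c' * X ^ (w - 1))) ∧
      q w = q (w - 1) + C c * X ^ (w - 1) := by
  have hmin (w : ℕ) (p : (ZMod b)[X]) : ∃ c : ZMod b, ∀ c' : ZMod b,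
      digitQuality b m η g r w (p + C c * X ^ (w - 1)) ≤
        digitQuality b m η g r w (p + C c' * X ^ (w - 1)) :=
    Finite.exists_min fun c => digitQuality b m η g r w (p + C c * X ^ (w - 1))
  choose c hc using hmin
  -- `Q n` is the polynomial with digits up to x^n fixed, that is, the stage w = n + 1.
  let Q : ℕ → (ZMod b)[X] := fun n =>
    Nat.rec 1 (fun n p => p + C (c (n + 2) p) * X ^ (n + 1)) n
  refine ⟨fun w => Q (w - 1), rfl, fun w hw => ?_⟩
  obtain ⟨n, rfl⟩ := Nat.exists_eq_add_of_le' hw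
  exact ⟨c (n + 2) (Q n), hc (n + 2) (Q n), rfl⟩

theorem exists_isCBCDBDRun (b : ℕ) [Fact b.Prime] (m d : ℕ) (η : ℕ → ℝ) :
    ∃ G : ℕ → ℕ → (ZMod b)[X], IsCBCDBDRun b m d η G := by
  induction d with
  | zero => exact ⟨fun _ _ => 1, rfl, fun _ _ _ => rfl, fun r _ h => absurd h (by omega)⟩
  | succ d ih =>
    obtain ⟨G, hG⟩ := ih
    rcases Nat.eq_zero_or_pos d with rfl | hd
    · exact ⟨G, hG.first, fun r h1 h2 => by omega, fun r h1 h2 => by omega⟩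
    obtain ⟨q, hq1, hq⟩ := exists_component b m η (fun j => G j m) d
    have hold {r : ℕ} (hr : r ≠ d) : Function.update G d q r = G r :=
      Function.update_of_ne hr _ _
    -- The criterion for component r sees only components j < r, so appending component d keeps all
    -- earlier choices minimal.
    have hQ {r : ℕ} (hr : r ≤ d) (w : ℕ) (p : (ZMod b)[X]) :
        digitQuality b m η (fun j => Function.update G d q j m) r w p =
          digitQuality b m η (fun j => G j m) r w p :=
      digitQuality_congr b m η (fun j hj => by rw [hold (by omega)]) w p
    refine ⟨Function.update G d q, ?_, fun r h1 h2 => ?_, fun r h1 h2 w hw hwm => ?_⟩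
    · rw [hold hd.ne]
      exact hG.first
    · rcases eq_or_ne r d with rfl | hr
      · rwa [Function.update_self]
      · rw [hold hr]
        exact hG.init r h1 (by omega)
    · simp only [hQ (show r ≤ d by omega)]
      rcases eq_or_ne r d with rfl | hr
      · rw [Function.update_self]
        exact hq w hw
      · rw [hold hr]
        exact hG.step r h1 (by omega) w hw hwm

variable {b : ℕ} [Fact b.Prime] {m d : ℕ} {η : ℕ → ℝ} {G : ℕ → ℕ → (ZMod b)[X]}

theorem IsCBCDBDRun.coeff_zero (h : IsCBCDBDRun b m d η G) {r w : ℕ} (hr : 1 ≤ r) (hrd : r < d)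
    (hw : 1 ≤ w) (hwm : w ≤ m) : (G r w).coeff 0 ≠ 0 := by
  induction w, hw using Nat.le_induction with
  | base => simp [h.init r hr hrd]
  | succ w hw ih =>
    obtain ⟨c, -, hc⟩ := h.step r hr hrd (w + 1) (by omega) hwm
    rw [hc, Nat.add_sub_cancel, coeff_add, coeff_mul_X_pow', if_neg (by omega), add_zero]
    exact ih (by omega)

theorem IsCBCDBDRun.coeff_zero_component (h : IsCBCDBDRun b m d η G) (hm : 1 ≤ m) {r : ℕ}
    (hrd : r < d) : (G r m).coeff 0 ≠ 0 := by
  rcases Nat.eq_zero_or_pos r with rfl | hr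
  · simp [h.first]
  · exact h.coeff_zero hr hrd hm le_rfl

theorem IsCBCDBDRun.condObjective_le (h : IsCBCDBDRun b m d η G) {r w : ℕ} (hr : 1 ≤ r)
    (hrd : r < d) (hw : 1 ≤ w) (hwm : w ≤ m) :
    condObjective b m η (fun j => G j m) r w (G r w) ≤
      condObjective b m η (fun j => G j m) r 1 1 := by
  induction w, hw using Nat.le_induction with
  | base => rw [h.init r hr hrd]
  | succ w hw ih =>
    obtain ⟨c, hc, hG⟩ := h.step r hr hrd (w + 1) (by omega) hwm
    rw [Nat.add_sub_cancel] at hc hG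
    rw [hG]
    exact (condObjective_succ_le b m η hw
      (fun j hj => h.coeff_zero_component (by omega) (hj.trans hrd))
      (h.coeff_zero hr hrd hw (by omega)) hc).trans (ih (by omega))

theorem IsCBCDBDRun.objective_le (h : IsCBCDBDRun b m d η G) (hη : ∀ j, 0 < η j) (hm : 1 ≤ m)
    {r : ℕ} (hr : 1 ≤ r) (hrd : r ≤ d) :
    objective b m η (fun j => G j m) r ≤ (b : ℝ) ^ m * ∏ j ∈ range r, (1 + η j) := by
  induction r, hr using Nat.le_induction with
  | base =>
    rw [prod_range_one]
    exact objective_one_le b m (hη 0) h.first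
  | succ r hr ih =>
    have h1 := h.condObjective_le hr hrd hm le_rfl
    rw [condObjective_self b m η (fun j => G j m) r] at h1
    refine h1.trans ((condObjective_one_le b m hη _ r).trans ?_)
    have := hη r
    rw [prod_range_succ, ← mul_assoc, mul_comm]
    exact mul_le_mul_of_nonneg_right (ih (by omega)) (by linarith)

theorem IsCBCDBDRun.truncQuality_le (h : IsCBCDBDRun b m d η G) (hη : ∀ j, 0 < η j) (hm : 1 ≤ m)
    (hd : 1 ≤ d) :
    truncQuality b m η (fun j : Fin d => G j m) (X ^ m) ≤
      1 / (b : ℝ) ^ m * ∏ j ∈ range d, (1 + η j * ((b - 1) * m + 1)) := by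
  have hb : (0 : ℝ) < (b : ℝ) ^ m := pow_pos (by exact_mod_cast (Fact.out : b.Prime).pos) m
  have h1 := prod_one_add_add_truncQuality_le b m hη fun j : Fin d => G j m
  rw [sum_prod_decaySum_eq_objective b m d η (g := fun j => G j m)
    fun j hj => h.coeff_zero_component hm hj] at h1
  have h2 := h.objective_le hη hm hd le_rfl
  rw [one_div, inv_mul_eq_div, le_div_iff₀ hb]
  -- The term b^m ∏ (1 + η_j) on the left of `h1` absorbs the bound `h2` on `objective`.
  linarith

end PolyLattice

theorem mainTheorem2 (b : ℕ) [Fact b.Prime] (m d : ℕ) (hm : 4 ≤ m) (hd : 1 ≤ d)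
    (η : ℕ → ℝ) (hη : ∀ j, 0 < η j) :
    (∃ g : Fin d → (ZMod b)[X], PolyLattice.IsCBCDBDOutput b m η g) ∧
    ∀ g : Fin d → (ZMod b)[X], PolyLattice.IsCBCDBDOutput b m η g →
      PolyLattice.truncQuality b m η g (X ^ m) ≤
        1 / (b : ℝ) ^ m *
          (∏ j ∈ Finset.range d, (1 + η j * (((b : ℝ) - 1) * m + 1)) +
            (b : ℝ) * m *
              ∏ j ∈ Finset.range d,
                (1 + η j * (2 * ((b : ℝ) - 1) * m + 2 * (b : ℝ) / ((b : ℝ) - 1)))) := by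
  have hb : (1 : ℝ) < b := by exact_mod_cast (Fact.out : b.Prime).one_lt
  have hb' : (0 : ℝ) < b - 1 := by linarith
  refine ⟨?_, ?_⟩
  · obtain ⟨G, hG⟩ := PolyLattice.exists_isCBCDBDRun b m d η
    exact ⟨fun j => G j m, G, hG, fun _ => rfl⟩
  · rintro g ⟨G, hG, hg⟩
    obtain rfl : g = fun j : Fin d => G j m := funext hg
    refine (hG.truncQuality_le hη (by omega) hd).trans ?_
    refine mul_le_mul_of_nonneg_left (le_add_of_nonneg_right ?_) (by positivity)
    refine mul_nonneg (by positivity) (Finset.prod_nonneg fun j _ => ?_)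
    have := hη j
    positivity
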